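/- **Notation.** Let $d\ge 2$, $k\ge 1$. All graphs $G$ have vertex set $\{1,\dots,k+1\}$, and $ij\in G$ means that $i<j$ and $\{i,j\}$ is an edge of $G$. For a tuple $\mathbf x=(x^1,\dots,x^{k+1})$ of points of $\mathbb R^d$ put $f_G(\mathbf x)=(|x^i-x^j|)_{ij\in G}$ and $F_G(\mathbf x)=(|x^i-x^j|^2)_{ij\in G}$, which are vectors in $\mathbb R^m$, where $m$ is the number of edges of $G$. For $E\subset\mathbb R^d$ let $\Delta(G,E^{k+1})=f_G(E^{k+1})\subset\mathbb R^m$. Let $\mathcal L^m$ be Lebesgue measure, $\mathcal H^t$ the $t$-dimensional Hausdorff measure, and $\dim$ the Hausdorff dimension. A set $H$ of edges of the complete graph $K_{k+1}$ is *independent with respect to* $\mathbf x$ if the rows of the Jacobian matrix $DF_{K_{k+1}}(\mathbf x)$ belonging to $H$ are linearly independent; it is *independent in $\mathbb R^d$* if it is so with respect to some $\mathbf x$. It is a *maximally independent subset of edges of $G$* if it is an independent set of edges of $G$ that is not contained in a larger one. For a nonempty set $H$ independent in $\mathbb R^d$, let $P_H(\mathbf x)$ be the sum of the squares of the $|H|\times|H|$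 minors of the rows of $DF_{K_{k+1}}(\mathbf x)$ belonging to $H$. A tuple $\mathbf x$ is *generic* if $\prod_H P_H(\mathbf x)\ne 0$, the product being over all such $H$. The graph $G$ is *infinitesimally rigid in $\mathbb R^d$* if $\ker DF_G(\mathbf x)=\ker DF_{K_{k+1}}(\mathbf x)$ for every generic $\mathbf x$, and *minimally infinitesimally rigid* if, moreover, no proper subgraph of $G$ on the same vertex set is infinitesimally rigid. **Theorem 2.4.** Let $d\ge 2$, $k\ge 1$ and $0<s<d-\binom d2/k$. There are connected graphs on $k+1$ vertices that are minimally infinitesimally rigid in $\mathbb R^d$, and there is a compact set $E\subset\mathbb R^d$ of Hausdorff dimension $s$ such that: 1. for every graph $G$ on $k+1$ vertices that is minimally infinitesimally rigid in $\mathbb R^d$, with $m$ edges, $\mathcal L^m(\Delta(G,E^{k+1}))=0$; 2. for every graph $G$ on $k+1$ vertices that is infinitesimally rigid in $\mathbb R^d$ and every maximally independent subset $H$ of edges of $G$, $\dim\Delta(G,E^{k+1})<|H|$ and $\mathcal H^{|H|}(\Delta(G,E^{k+1}))=0$. Thus neither the conclusion "$\mathcal L^m(\Delta(G,E^{k+1}))>0$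 for connected minimally infinitesimally rigid $G$" (Theorem 2.1) nor the conclusion "$\dim\Delta(G,E^{k+1})=|H|$ and $\mathcal H^{|H|}(\Delta(G,E^{k+1}))>0$ for $G$ without isolated vertices and $H$ a maximally independent subset of its edges" (Theorem 2.2) holds in general for compact $E\subset\mathbb R^d$ of Hausdorff dimension $s<d-\binom d2/k$. -/

import Mathlib

open MeasureTheory

open scoped ENNReal

namespace Framework

/-- The tuples `(x¹, …, xⁿ)` of points of `ℝᵈ`. -/
abbrev Tuple (d n : ℕ) : Type := Fin n → EuclideanSpace ℝ (Fin d)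

/-- The edges `ij`, `i < j`, of the complete graph on `n` vertices. -/
abbrev Edge (n : ℕ) : Type := {p : Fin n × Fin n // p.1 < p.2}

open Classical in
/-- The edge set of a graph on the vertex set `Fin n`. -/
noncomputable def edges {n : ℕ} (G : SimpleGraph (Fin n)) : Finset (Edge n) :=
  Finset.univ.filter fun e => G.Adj e.1.1 e.1.2

/-- The distance function `f_G(x) = (|xⁱ - xʲ|)_{ij ∈ G}` with values in `ℝᵐ`, where `m` is the
number of edges of `G` and the coordinates are labelled by the edges. -/
noncomputable def distMap {n : ℕ} (d : ℕ) (G : SimpleGraph (Fin n)) (x : Tuple d n) :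
    EuclideanSpace ℝ (edges G) :=
  WithLp.toLp 2 fun e => dist (x e.1.1.1) (x e.1.1.2)

/-- The distance-squared function `F_G(x) = (|xⁱ - xʲ|²)_{ij ∈ G}`. -/
noncomputable def sqDistMap {n : ℕ} (d : ℕ) (G : SimpleGraph (Fin n)) (x : Tuple d n) :
    EuclideanSpace ℝ (edges G) :=
  WithLp.toLp 2 fun e => dist (x e.1.1.1) (x e.1.1.2) ^ 2

/-- The set `Δ(G, Eⁿ)` of `G`-distances realized by `n`-tuples of points of `E`. -/
noncomputable def distSet {n d : ℕ} (G : SimpleGraph (Fin n))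
    (E : Set (EuclideanSpace ℝ (Fin d))) : Set (EuclideanSpace ℝ (edges G)) :=
  distMap d G '' {x : Tuple d n | ∀ i, x i ∈ E}

/-- The Jacobian matrix of the distance-squared function of the complete graph. Its rows are
labelled by the edges, its columns by the coordinates of the points of the tuple. -/
noncomputable def jacobian {d n : ℕ} (x : Tuple d n) : Matrix (Edge n) (Fin n × Fin d) ℝ :=
  fun e c => fderiv ℝ (fun y : Tuple d n => dist (y e.1.1) (y e.1.2) ^ 2) x
    (Pi.single c.1 (EuclideanSpace.single c.2 1))

/-- The set `H` of edges of the complete graph is independent in `ℝᵈ` with respect to `x`. -/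
def IndependentAt {d n : ℕ} (H : Finset (Edge n)) (x : Tuple d n) : Prop :=
  LinearIndependent ℝ fun e : H => jacobian x e.1

/-- The set `H` of edges of the complete graph is independent in `ℝᵈ`. -/
def Independent {n : ℕ} (d : ℕ) (H : Finset (Edge n)) : Prop :=
  ∃ x : Tuple d n, IndependentAt H x

/-- `H` is a maximally independent (in `ℝᵈ`) subset of the edge set of `G`. -/
def MaximallyIndependent {n : ℕ} (d : ℕ) (G : SimpleGraph (Fin n)) (H : Finset (Edge n)) : Prop :=
  H ⊆ edges G ∧ Independent d H ∧ ∀ H' : Finset (Edge n), H' ⊆ edges G → H ⊂ H' → ¬ Independent d H'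

/-- `P_H(x)`: the sum of the squares of the `|H| × |H|` minors of the rows of the Jacobian matrix
that belong to `H`. The set `A` of columns is matched with `H` by some bijection; the square of the
minor does not depend on it. -/
noncomputable def minorSum {d n : ℕ} (H : Finset (Edge n)) (x : Tuple d n) : ℝ :=
  ∑ A : {A : Finset (Fin n × Fin d) // H.card = A.card},
    (Matrix.det fun e e' : H => jacobian x e.1 (Finset.equivOfCardEq A.2 e').1) ^ 2

open Classical in
/-- `P(x)`: the product of all `P_H(x)` with `H` nonempty and independent in `ℝᵈ`. -/
noncomputable def criticalPoly {d n : ℕ} (x : Tuple d n) : ℝ :=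
  ∏ H : Finset (Edge n) with H.Nonempty ∧ Independent d H, minorSum H x

/-- Generic tuples are those outside the zero set of `P`. -/
def IsGeneric {d n : ℕ} (x : Tuple d n) : Prop := criticalPoly x ≠ 0

/-- The space `𝒱(G, x)` of infinitesimal motions of `G` at `x`: the kernel of `DF_G(x)`. -/
noncomputable def infMotions {d n : ℕ} (G : SimpleGraph (Fin n)) (x : Tuple d n) :
    Submodule ℝ (Tuple d n) :=
  LinearMap.ker (fderiv ℝ (sqDistMap d G) x).toLinearMap

/-- `G` is infinitesimally rigid in `ℝᵈ`: at every generic tuple its infinitesimal motions are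
those of the complete graph. -/
def InfRigid {n : ℕ} (d : ℕ) (G : SimpleGraph (Fin n)) : Prop :=
  ∀ x : Tuple d n, IsGeneric x → infMotions G x = infMotions (⊤ : SimpleGraph (Fin n)) x

/-- `G` is minimally infinitesimally rigid in `ℝᵈ`: it is infinitesimally rigid and no proper
subgraph on the same vertices is. -/
def MinInfRigid {n : ℕ} (d : ℕ) (G : SimpleGraph (Fin n)) : Prop :=
  InfRigid d G ∧ ∀ G' : SimpleGraph (Fin n), G' < G → ¬ InfRigid d G'

end Framework

/-!
The set `E` is the `d`-th power of a Cantor set `C` of reals of dimension `α = s / d` that behaves,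
dimensionally, like a group: the powers of `C - C` have no larger dimension than those of `C`. It
consists of the sums `∑ aⱼ uⱼ` with `0 ≤ aⱼ < q ^ (2 j + 1)`, where the place values `uⱼ` decrease
so fast that different digit sequences give well separated sums. Taking differences at most doubles
the number of values of each digit. The first `j` digits together take `q ^ (j ^ 2)` values, so the
loss of a factor `2 ^ j` is invisible to the dimension (`MixedRadix.dimH_pi_diffSet_le`). For the
lower bound on the dimension, replacing `uⱼ` by the place values of a true mixed radix expansion
maps `C` onto a set containing `[0, 1)`, and this map is Hölder continuous of exponent `α`
(`MixedRadix.abs_denseSum_sub_le_rpow`, `MixedRadix.le_dimH_pi_cantor`).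

Distances do not change when a tuple is translated so that its first point is the origin. Thus every
distance set of `E` is a Lipschitz image of `(C - C) ^ (k d)` and has dimension at most `k s`
(`Framework.dimH_distSet_coordProd_le`), and by hypothesis `k s < d k - d.choose 2`.

It remains to see that a rigid graph has at least `d k - d.choose 2` edges, and so has every
maximally independent set of its edges. At a generic tuple, the differentials of the squared lengths
of such a set of edges span those of all edges of the complete graph, by rigidity and maximality. On
the other hand the edges that meet the first `d` vertices are independent
(`Framework.independent_fullRankEdges`), and there are at least `d k - d.choose 2` of them. Generic
tuples exist because the condition is the nonvanishing of a product of nonzero polynomials.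
Connectedness of rigid graphs holds because moving a single component of a disconnected graph is an
infinitesimal motion that the complete graph does not have.
-/

namespace MixedRadix

/-! ### Geometrically dominated series -/

section Geometric

variable {w c : ℕ → ℝ}

theorem le_mul_pow_of_succ_le (hw : ∀ j, w (j + 1) ≤ w j / 4) (j i : ℕ) :
    w (i + j) ≤ w j * (1 / 4) ^ i := by
  induction i with
  | zero => simp
  | succ i ih =>
    have := hw (i + j)
    rw [show i + 1 + j = i + j + 1 by ring, pow_succ]
    linarith

theorem summable_of_abs_le (hw : ∀ j, w (j + 1) ≤ w j / 4) (hc : ∀ j, |c j| ≤ w j) :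
    Summable c := by
  have hs : Summable fun i : ℕ => w 0 * (1 / 4 : ℝ) ^ i :=
    (summable_geometric_of_lt_one (by norm_num) (by norm_num)).mul_left _
  refine hs.of_norm_bounded fun i => ?_
  rw [Real.norm_eq_abs]
  exact (hc i).trans (le_mul_pow_of_succ_le hw 0 i)

theorem abs_tsum_nat_add_le (hw : ∀ j, w (j + 1) ≤ w j / 4) (hc : ∀ j, |c j| ≤ w j) (j : ℕ) :
    |∑' i, c (i + j)| ≤ 4 / 3 * w j := by
  have hs : HasSum (fun i : ℕ => w j * (1 / 4 : ℝ) ^ i) (4 / 3 * w j) := by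
    have := (hasSum_geometric_of_lt_one (r := (1 / 4 : ℝ)) (by norm_num) (by norm_num)).mul_left
      (w j)
    rwa [show w j * (1 - 1 / 4 : ℝ)⁻¹ = 4 / 3 * w j by ring] at this
  rw [← Real.norm_eq_abs]
  refine tsum_of_norm_bounded hs fun i => ?_
  rw [Real.norm_eq_abs]
  exact (hc _).trans (le_mul_pow_of_succ_le hw j i)

end Geometric

/-! ### Digit sequences and the two expansions -/

/-- Digit sequences for the mixed radix system in which the `j`-th digit takes `q ^ (2 * j + 1)`
values. The first `j` digits together take `q ^ (j ^ 2)` values. -/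
abbrev Digits (q : ℕ) : Type := ∀ j : ℕ, Fin (q ^ (2 * j + 1))

/-- The length `(q ^ (j ^ 2)) ^ (-1 / α)` at which `q ^ (j ^ 2)` intervals cover a set of
dimension `α`. -/
noncomputable def scale (q : ℕ) (α : ℝ) (j : ℕ) : ℝ := ((q : ℝ) ^ (j ^ 2)) ^ (-α⁻¹)

/-- The place value of the `j`-th digit in the sparse expansion: the multiples of it by the values
of that digit form an arithmetic progression filling an interval of length `scale q α j`. -/
noncomputable def place (q : ℕ) (α : ℝ) (j : ℕ) : ℝ := scale q α j / (q : ℝ) ^ (2 * j + 1)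

/-- The point of the Cantor set with a given digit sequence. -/
noncomputable def sparseSum (q : ℕ) (α : ℝ) (a : Digits q) : ℝ := ∑' j, (a j : ℝ) * place q α j

/-- The point of `[0, 1]` whose mixed radix expansion is a given digit sequence. -/
noncomputable def denseSum (q : ℕ) (a : Digits q) : ℝ := ∑' j, (a j : ℝ) / (q : ℝ) ^ ((j + 1) ^ 2)

/-- The Cantor set of all sparse expansions. -/
def cantor (q : ℕ) (α : ℝ) : Set ℝ := Set.range (sparseSum q α)

variable {q : ℕ} {α : ℝ}

theorem scale_pos (hq : 1 < q) (j : ℕ) : 0 < scale q α j := by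
  have : (0 : ℝ) < q := by positivity
  unfold scale; positivity

theorem place_pos (hq : 1 < q) (j : ℕ) : 0 < place q α j := by
  have : (0 : ℝ) < q := by positivity
  have := scale_pos (α := α) hq j
  unfold place; positivity

theorem scale_rpow (hq : 1 < q) (h0 : 0 < α) (j : ℕ) :
    scale q α j ^ α = 1 / (q : ℝ) ^ (j ^ 2) := by
  have hq' : (0 : ℝ) < q := by positivity
  rw [scale, ← Real.rpow_mul (by positivity), neg_mul, inv_mul_cancel₀ h0.ne', Real.rpow_neg_one,
    one_div]

theorem pow_mul_place (hq : 1 < q) (j : ℕ) :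
    (q : ℝ) ^ (2 * j + 1) * place q α j = scale q α j := by
  have hq' : (0 : ℝ) < q := by positivity
  unfold place; field_simp

theorem scale_succ_le (hq : 1 < q) (h1 : α⁻¹ > 1) (h4 : 4 ≤ (q : ℝ) ^ (α⁻¹ - 1)) (j : ℕ) :
    scale q α (j + 1) ≤ place q α j / 4 := by
  have hq' : (1 : ℝ) < q := by exact_mod_cast hq
  have hb : (q : ℝ) ≤ (q : ℝ) ^ (2 * j + 1) := le_self_pow₀ hq'.le (by omega)
  set b : ℝ := (q : ℝ) ^ (2 * j + 1) with hbdef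
  have hb0 : 0 < b := by positivity
  have hB : (q : ℝ) ^ ((j + 1) ^ 2) = (q : ℝ) ^ (j ^ 2) * b := by
    rw [hbdef, ← pow_add]; congr 1; ring
  have h4' : 4 ≤ b ^ (α⁻¹ - 1) := h4.trans (Real.rpow_le_rpow (by positivity) hb (by linarith))
  have e : b ^ (-α⁻¹) * b ^ (α⁻¹ - 1) * b = 1 := by
    rw [← Real.rpow_add hb0, ← Real.rpow_add_one hb0.ne']
    ring_nf; simp
  have hle : 4 * b ^ (-α⁻¹) * b ≤ 1 := by
    rw [← e]
    have : 0 < b ^ (-α⁻¹) * b := by positivity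
    nlinarith
  have hs := scale_pos (α := α) hq j
  have : scale q α (j + 1) = scale q α j * b ^ (-α⁻¹) := by
    unfold scale; rw [hB, Real.mul_rpow (by positivity) hb0.le]
  rw [this, place, ← hbdef, div_div, le_div_iff₀ (by positivity)]
  nlinarith

theorem place_le_scale (hq : 1 < q) (j : ℕ) : place q α j ≤ scale q α j := by
  have hq' : (1 : ℝ) < q := by exact_mod_cast hq
  exact div_le_self (scale_pos hq j).le (one_le_pow₀ hq'.le)

theorem scale_succ_le_scale (hq : 1 < q) (h1 : α⁻¹ > 1) (h4 : 4 ≤ (q : ℝ) ^ (α⁻¹ - 1)) (j : ℕ) :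
    scale q α (j + 1) ≤ scale q α j / 4 :=
  (scale_succ_le hq h1 h4 j).trans (by linarith [place_le_scale (α := α) hq j])

theorem digit_le (a : Digits q) (j : ℕ) : (a j : ℝ) ≤ (q : ℝ) ^ (2 * j + 1) := by
  exact_mod_cast (a j).2.le

theorem abs_digit_sub_le (a a' : Digits q) (j : ℕ) :
    |(a j : ℝ) - a' j| ≤ (q : ℝ) ^ (2 * j + 1) := by
  have := digit_le a j
  have := digit_le a' j
  have : (0 : ℝ) ≤ a j := by positivity
  have : (0 : ℝ) ≤ a' j := by positivity
  rw [abs_le]; constructor <;> linarith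

theorem abs_digit_mul_place_le (hq : 1 < q) (a : Digits q) (j : ℕ) :
    |(a j : ℝ) * place q α j| ≤ scale q α j := by
  have := place_pos (α := α) hq j
  rw [abs_of_nonneg (by positivity), ← pow_mul_place hq]
  gcongr
  exact digit_le a j

theorem abs_digit_sub_mul_place_le (hq : 1 < q) (a a' : Digits q) (j : ℕ) :
    |((a j : ℝ) - a' j) * place q α j| ≤ scale q α j := by
  have := place_pos (α := α) hq j
  rw [abs_mul, abs_of_pos this, ← pow_mul_place hq]
  gcongr
  exact abs_digit_sub_le a a' j

theorem isCompact_cantor (hq : 1 < q) (h1 : α⁻¹ > 1) (h4 : 4 ≤ (q : ℝ) ^ (α⁻¹ - 1)) :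
    IsCompact (cantor q α) := by
  refine isCompact_range ?_
  refine continuous_tsum (u := scale q α) (fun j => ?_) ?_ fun j a => abs_digit_mul_place_le hq a j
  · have : Continuous fun n : Fin (q ^ (2 * j + 1)) => ((n : ℕ) : ℝ) * place q α j :=
      continuous_of_discreteTopology
    exact this.comp (continuous_apply j)
  · exact summable_of_abs_le (scale_succ_le_scale hq h1 h4) fun j => (abs_of_pos (scale_pos hq j)).le

theorem zero_mem_cantor (hq : 1 < q) : (0 : ℝ) ∈ cantor q α :=
  ⟨fun j => ⟨0, by positivity⟩, by simp [sparseSum]⟩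

/-- Differences of sparse expansions, split after the first `j` digits. -/
theorem sparseSum_sub (hq : 1 < q) (h1 : α⁻¹ > 1) (h4 : 4 ≤ (q : ℝ) ^ (α⁻¹ - 1))
    (a a' : Digits q) (j : ℕ) :
    sparseSum q α a - sparseSum q α a' =
      ∑ i ∈ Finset.range j, ((a i : ℝ) - a' i) * place q α i +
        ∑' i, ((a (i + j) : ℝ) - a' (i + j)) * place q α (i + j) := by
  have hs := scale_succ_le_scale hq h1 h4
  rw [Summable.sum_add_tsum_nat_add (f := fun i => ((a i : ℝ) - a' i) * place q α i) j
    (summable_of_abs_le hs (abs_digit_sub_mul_place_le hq a a'))]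
  simp_rw [sub_mul]
  exact ((summable_of_abs_le hs (abs_digit_mul_place_le hq a)).tsum_sub
    (summable_of_abs_le hs (abs_digit_mul_place_le hq a'))).symm

theorem hasSum_telescope (hq : 1 < q) (j : ℕ) :
    HasSum (fun i => 1 / (q : ℝ) ^ ((i + j) ^ 2) - 1 / (q : ℝ) ^ ((i + j + 1) ^ 2))
      (1 / (q : ℝ) ^ (j ^ 2)) := by
  have hq' : (1 : ℝ) < q := by exact_mod_cast hq
  rw [hasSum_iff_tendsto_nat_of_nonneg]
  · have : ∀ n, ∑ i ∈ Finset.range n,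
        (1 / (q : ℝ) ^ ((i + j) ^ 2) - 1 / (q : ℝ) ^ ((i + j + 1) ^ 2)) =
        1 / (q : ℝ) ^ (j ^ 2) - 1 / (q : ℝ) ^ ((n + j) ^ 2) := fun n => by
      have := Finset.sum_range_sub' (fun i => 1 / (q : ℝ) ^ ((i + j) ^ 2)) n
      simp only [zero_add] at this
      rw [← this]
      exact Finset.sum_congr rfl fun i _ => by rw [show i + 1 + j = i + j + 1 by ring]
    simp_rw [this]
    have ht : Filter.Tendsto (fun n : ℕ => 1 / (q : ℝ) ^ ((n + j) ^ 2)) Filter.atTop (nhds 0) := by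
      simp_rw [one_div]
      refine (tendsto_pow_atTop_atTop_of_one_lt hq').inv_tendsto_atTop.comp ?_
      exact Filter.tendsto_atTop_mono (fun n => (Nat.le_add_right n j).trans
        (Nat.le_self_pow two_ne_zero _)) Filter.tendsto_id
    simpa using tendsto_const_nhds.sub ht
  · intro i
    rw [sub_nonneg]
    exact one_div_le_one_div_of_le (by positivity)
      (pow_le_pow_right₀ hq'.le (Nat.pow_le_pow_left (Nat.le_succ _) 2))

theorem abs_dense_term_le (hq : 1 < q) (c : ℝ) (j : ℕ) (hc : |c| ≤ (q : ℝ) ^ (2 * j + 1) - 1) :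
    |c / (q : ℝ) ^ ((j + 1) ^ 2)| ≤ 1 / (q : ℝ) ^ (j ^ 2) - 1 / (q : ℝ) ^ ((j + 1) ^ 2) := by
  have hq' : (0 : ℝ) < q := by positivity
  have hB : (q : ℝ) ^ ((j + 1) ^ 2) = (q : ℝ) ^ (j ^ 2) * (q : ℝ) ^ (2 * j + 1) := by
    rw [← pow_add]; congr 1; ring
  rw [abs_div, abs_of_pos (a := (q : ℝ) ^ ((j + 1) ^ 2)) (by positivity), hB]
  have : 1 / (q : ℝ) ^ (j ^ 2) - 1 / ((q : ℝ) ^ (j ^ 2) * (q : ℝ) ^ (2 * j + 1)) =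
    ((q : ℝ) ^ (2 * j + 1) - 1) / ((q : ℝ) ^ (j ^ 2) * (q : ℝ) ^ (2 * j + 1)) := by field_simp
  rw [this]
  gcongr

theorem digit_le_sub_one (a : Digits q) (j : ℕ) : (a j : ℝ) ≤ (q : ℝ) ^ (2 * j + 1) - 1 := by
  have := (a j).2
  have : ((a j : ℕ) : ℝ) + 1 ≤ (q : ℝ) ^ (2 * j + 1) := by exact_mod_cast this
  linarith

theorem abs_digit_sub_le_sub_one (a a' : Digits q) (j : ℕ) :
    |(a j : ℝ) - a' j| ≤ (q : ℝ) ^ (2 * j + 1) - 1 := by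
  have := digit_le_sub_one a j
  have := digit_le_sub_one a' j
  have : (0 : ℝ) ≤ a j := by positivity
  have : (0 : ℝ) ≤ a' j := by positivity
  rw [abs_le]; constructor <;> linarith

theorem summable_dense (hq : 1 < q) (a : Digits q) :
    Summable fun j => (a j : ℝ) / (q : ℝ) ^ ((j + 1) ^ 2) := by
  refine (hasSum_telescope hq 0).summable.of_norm_bounded fun i => ?_
  refine abs_dense_term_le hq _ i ?_
  rw [abs_of_nonneg (by positivity)]
  exact digit_le_sub_one a i

theorem abs_denseSum_sub_le (hq : 1 < q) (a a' : Digits q) (j : ℕ) (h : ∀ i < j, a i = a' i) :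
    |denseSum q a - denseSum q a'| ≤
      |(a j : ℝ) - a' j| / (q : ℝ) ^ ((j + 1) ^ 2) + 1 / (q : ℝ) ^ ((j + 1) ^ 2) := by
  have hq' : (0 : ℝ) < q := by positivity
  have hd : denseSum q a - denseSum q a' = ∑' i, ((a i : ℝ) - a' i) / (q : ℝ) ^ ((i + 1) ^ 2) := by
    simp_rw [sub_div]
    exact ((summable_dense hq a).tsum_sub (summable_dense hq a')).symm
  have hs : Summable fun i => ((a i : ℝ) - a' i) / (q : ℝ) ^ ((i + 1) ^ 2) := by
    simp_rw [sub_div]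
    exact (summable_dense hq a).sub (summable_dense hq a')
  rw [hd, ← hs.sum_add_tsum_nat_add (j + 1), Finset.sum_range_succ, Finset.sum_eq_zero, zero_add]
  · refine (abs_add_le _ _).trans (add_le_add ?_ ?_)
    · rw [abs_div, abs_of_pos (a := (q : ℝ) ^ ((j + 1) ^ 2)) (by positivity)]
    · rw [← Real.norm_eq_abs]
      exact tsum_of_norm_bounded (hasSum_telescope hq (j + 1)) fun i =>
        abs_dense_term_le hq _ (i + (j + 1)) (abs_digit_sub_le_sub_one a a' _)
  · intro i hi
    rw [h i (Finset.mem_range.1 hi)]; simp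

/-- The map sending a sparse expansion to the dense expansion with the same digits is Hölder
continuous of exponent `α`: if the digits first differ in place `j`, by `t`, then the sparse
expansions are at least `t * place q α j / 2` apart, the dense ones at most
`2 * t / q ^ ((j + 1) ^ 2)`. -/
theorem abs_denseSum_sub_le_rpow (hq : 1 < q) (h0 : 0 < α) (h1 : α < 1)
    (h4 : 4 ≤ (q : ℝ) ^ (α⁻¹ - 1)) (a a' : Digits q) :
    |denseSum q a - denseSum q a'| ≤ 4 * |sparseSum q α a - sparseSum q α a'| ^ α := by
  have h1' : α⁻¹ > 1 := (one_lt_inv₀ h0).2 h1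
  have hq' : (0 : ℝ) < q := by positivity
  by_cases haa : a = a'
  · subst haa; simp; positivity
  obtain ⟨j, hj, hlt⟩ : ∃ j, a j ≠ a' j ∧ ∀ i < j, a i = a' i := by
    classical
    have hex : ∃ j, a j ≠ a' j := Function.ne_iff.1 haa
    exact ⟨Nat.find hex, Nat.find_spec hex, fun i hi => by simpa using Nat.find_min hex hi⟩
  set t : ℝ := |(a j : ℝ) - a' j| with ht
  have ht1 : 1 ≤ t := by
    have hne : ((a j : ℕ) : ℤ) - (a' j : ℕ) ≠ 0 := by
      rw [sub_ne_zero]; exact_mod_cast fun h => hj (Fin.ext h)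
    have := Int.one_le_abs hne
    have h2 : ((1 : ℤ) : ℝ) ≤ ((|((a j : ℕ) : ℤ) - (a' j : ℕ)| : ℤ) : ℝ) := by exact_mod_cast this
    push_cast at h2
    exact h2
  have htb : t ≤ (q : ℝ) ^ (2 * j + 1) := abs_digit_sub_le a a' j
  have hp := place_pos (α := α) hq j
  have hsparse : t * place q α j / 2 ≤ |sparseSum q α a - sparseSum q α a'| := by
    rw [sparseSum_sub hq h1' h4 a a' (j + 1), Finset.sum_range_succ, Finset.sum_eq_zero, zero_add]
    · have hT := abs_tsum_nat_add_le (scale_succ_le_scale hq h1' h4)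
        (abs_digit_sub_mul_place_le hq a a') (j + 1)
      have hsc := scale_succ_le hq h1' h4 j
      have := abs_sub_abs_le_abs_sub (((a j : ℝ) - a' j) * place q α j)
        (-∑' i, ((a (i + (j + 1)) : ℝ) - a' (i + (j + 1))) * place q α (i + (j + 1)))
      rw [sub_neg_eq_add, abs_neg, abs_mul, ← ht, abs_of_pos hp] at this
      nlinarith
    · intro i hi
      rw [hlt i (Finset.mem_range.1 hi)]; simp
  have hdense := abs_denseSum_sub_le hq a a' j hlt
  rw [← ht] at hdense
  set b : ℝ := (q : ℝ) ^ (2 * j + 1) with hb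
  have hb0 : 0 < b := by positivity
  have hB : (q : ℝ) ^ ((j + 1) ^ 2) = (q : ℝ) ^ (j ^ 2) * b := by
    rw [hb, ← pow_add]; congr 1; ring
  have hkey : t / (q : ℝ) ^ ((j + 1) ^ 2) ≤ (t * place q α j) ^ α := by
    have e : t * place q α j = (t / b) * scale q α j := by rw [place, ← hb]; ring
    rw [e, Real.mul_rpow (by positivity) (scale_pos hq j).le, scale_rpow hq h0, hB]
    have : t / b ≤ (t / b) ^ α :=
      Real.self_le_rpow_of_le_one (by positivity) ((div_le_one hb0).2 htb) h1.le
    calc t / ((q : ℝ) ^ (j ^ 2) * b) = t / b * (1 / (q : ℝ) ^ (j ^ 2)) := by field_simp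
      _ ≤ _ := by gcongr
  have h2 : (t * place q α j) ^ α ≤ 2 * |sparseSum q α a - sparseSum q α a'| ^ α := by
    calc (t * place q α j) ^ α ≤ (2 * |sparseSum q α a - sparseSum q α a'|) ^ α := by
          exact Real.rpow_le_rpow (by positivity) (by linarith) h0.le
      _ = 2 ^ α * |sparseSum q α a - sparseSum q α a'| ^ α :=
          Real.mul_rpow (by norm_num) (abs_nonneg _)
      _ ≤ 2 ^ (1 : ℝ) * |sparseSum q α a - sparseSum q α a'| ^ α := by
          gcongr; norm_num
      _ = _ := by norm_num
  have h3 : 1 / (q : ℝ) ^ ((j + 1) ^ 2) ≤ t / (q : ℝ) ^ ((j + 1) ^ 2) := by gcongr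
  linarith

/-- Every number in `[0, 1)` has a mixed radix expansion. -/
theorem Ico_subset_range_denseSum (hq : 1 < q) : Set.Ico (0 : ℝ) 1 ⊆ Set.range (denseSum q) := by
  intro y hy
  have hq' : (1 : ℝ) < q := by exact_mod_cast hq
  refine ⟨fun j => ⟨⌊y * (q : ℝ) ^ ((j + 1) ^ 2)⌋₊ % q ^ (2 * j + 1),
    Nat.mod_lt _ (by positivity)⟩, ?_⟩
  refine HasSum.tsum_eq ?_
  rw [hasSum_iff_tendsto_nat_of_nonneg fun i => by positivity]
  -- The digits are chosen such that the partial sums telescope to `y` rounded down to a multiple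
  -- of `1 / q ^ (n ^ 2)`.
  have hterm : ∀ i : ℕ, ((⌊y * (q : ℝ) ^ ((i + 1) ^ 2)⌋₊ % q ^ (2 * i + 1) : ℕ) : ℝ) /
      (q : ℝ) ^ ((i + 1) ^ 2) = (⌊y * (q : ℝ) ^ ((i + 1) ^ 2)⌋₊ : ℝ) / (q : ℝ) ^ ((i + 1) ^ 2) -
        (⌊y * (q : ℝ) ^ (i ^ 2)⌋₊ : ℝ) / (q : ℝ) ^ (i ^ 2) := fun i => by
    have hB : (q : ℝ) ^ ((i + 1) ^ 2) = (q : ℝ) ^ (i ^ 2) * (q : ℝ) ^ (2 * i + 1) := by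
      rw [← pow_add]; congr 1; ring
    have hfl : ⌊y * (q : ℝ) ^ (i ^ 2)⌋₊ = ⌊y * (q : ℝ) ^ ((i + 1) ^ 2)⌋₊ / q ^ (2 * i + 1) := by
      rw [← Nat.floor_div_natCast (K := ℝ), hB]
      congr 1; push_cast; field_simp
    have hmod := Nat.mod_add_div ⌊y * (q : ℝ) ^ ((i + 1) ^ 2)⌋₊ (q ^ (2 * i + 1))
    rw [← hfl] at hmod
    have hmod' : ((⌊y * (q : ℝ) ^ ((i + 1) ^ 2)⌋₊ % q ^ (2 * i + 1) : ℕ) : ℝ) +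
        (q : ℝ) ^ (2 * i + 1) * (⌊y * (q : ℝ) ^ (i ^ 2)⌋₊ : ℝ) =
        ⌊y * (q : ℝ) ^ ((i + 1) ^ 2)⌋₊ := by exact_mod_cast hmod
    rw [← hmod', hB]
    field_simp
    ring
  simp only [hterm]
  simp_rw [Finset.sum_range_sub (fun i => (⌊y * (q : ℝ) ^ (i ^ 2)⌋₊ : ℝ) / (q : ℝ) ^ (i ^ 2))]
  have h00 : ⌊y⌋₊ = 0 := Nat.floor_eq_zero.2 hy.2
  simp only [ne_eq, OfNat.ofNat_ne_zero, not_false_eq_true, zero_pow, pow_zero, mul_one, h00,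
    Nat.cast_zero, div_one, sub_zero]
  have hlim : Filter.Tendsto (fun n : ℕ => (q : ℝ) ^ (n ^ 2)) Filter.atTop Filter.atTop := by
    refine (tendsto_pow_atTop_atTop_of_one_lt hq').comp ?_
    exact Filter.tendsto_atTop_mono (fun n => Nat.le_self_pow two_ne_zero n) Filter.tendsto_id
  exact (tendsto_nat_floor_mul_div_atTop hy.1).comp hlim

/-! ### Dimension of powers of the Cantor set and of its difference set -/

/-- The set of differences of points of the Cantor set. -/
def diffSet (q : ℕ) (α : ℝ) : Set ℝ := Set.image2 (fun x y => x - y) (cantor q α) (cantor q α)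

theorem cantor_subset_diffSet (hq : 1 < q) : cantor q α ⊆ diffSet q α := fun x hx =>
  ⟨x, hx, 0, zero_mem_cantor hq, sub_zero x⟩

theorem prod_two_mul_pow (q j : ℕ) :
    ∏ i : Fin j, (2 * q ^ (2 * (i : ℕ) + 1)) = 2 ^ j * q ^ (j ^ 2) := by
  rw [Fin.prod_univ_eq_prod_range (fun i => 2 * q ^ (2 * i + 1)) j]
  induction j with
  | zero => simp
  | succ j ih => rw [Finset.prod_range_succ, ih]; ring

/-- A centre of one of the `2 ^ j * q ^ (j ^ 2)` intervals that cover the difference set at the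
scale `scale q α j`. -/
noncomputable def coverCentre (q : ℕ) (α : ℝ) (j : ℕ)
    (c : ∀ i : Fin j, Fin (2 * q ^ (2 * (i : ℕ) + 1))) : ℝ :=
  ∑ i : Fin j, ((c i : ℝ) - (q : ℝ) ^ (2 * (i : ℕ) + 1)) * place q α i

theorem exists_abs_sub_coverCentre_le (hq : 1 < q) (h1 : α⁻¹ > 1)
    (h4 : 4 ≤ (q : ℝ) ^ (α⁻¹ - 1)) {z : ℝ} (hz : z ∈ diffSet q α) (j : ℕ) :
    ∃ c, |z - coverCentre q α j c| ≤ 2 * scale q α j := by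
  obtain ⟨_, ⟨a, rfl⟩, _, ⟨a', rfl⟩, rfl⟩ := hz
  have hlt (i : ℕ) : (a i : ℕ) + (q ^ (2 * i + 1) - a' i) < 2 * q ^ (2 * i + 1) := by
    have := (a i).2
    omega
  -- Shifting the digit differences by `q ^ (2 * i + 1)` makes them nonnegative.
  refine ⟨fun i => ⟨_, hlt i⟩, ?_⟩
  have hc : coverCentre q α j (fun i => ⟨_, hlt i⟩) =
      ∑ i ∈ Finset.range j, ((a i : ℝ) - a' i) * place q α i := by
    rw [← Fin.sum_univ_eq_sum_range (fun i => ((a i : ℝ) - a' i) * place q α i), coverCentre]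
    refine Finset.sum_congr rfl fun i _ => ?_
    rw [Nat.cast_add, Nat.cast_sub (a' i).2.le]
    push_cast
    ring
  have hT := abs_tsum_nat_add_le (scale_succ_le_scale hq h1 h4)
    (abs_digit_sub_mul_place_le hq a a') j
  have := scale_pos (α := α) hq j
  simp only [hc, sparseSum_sub hq h1 h4 a a' j, add_sub_cancel_left]
  linarith

/-- The number of covering intervals exceeds `q ^ (j ^ 2)` by a factor `2 ^ j` only, which any
increase of the exponent absorbs. -/
theorem eventually_card_mul_scale_le (hq : 1 < q) (h0 : 0 < α) {β : ℝ} (hβ : α < β) :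
    ∀ᶠ j : ℕ in Filter.atTop,
      (2 ^ j * (q : ℝ) ^ (j ^ 2)) * (4 * scale q α j) ^ β ≤ 4 ^ β := by
  have hq' : (1 : ℝ) < q := by exact_mod_cast hq
  have hq0 : (0 : ℝ) < q := by positivity
  have hδ : 0 < β / α - 1 := by rw [sub_pos, one_lt_div h0]; exact hβ
  have hδq : 1 < (q : ℝ) ^ (β / α - 1) := Real.one_lt_rpow hq' hδ
  filter_upwards [(tendsto_pow_atTop_atTop_of_one_lt hδq).eventually_ge_atTop 2] with j hj
  have hB : (0 : ℝ) < (q : ℝ) ^ (j ^ 2) := by positivity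
  have h2 : (2 : ℝ) ^ j ≤ ((q : ℝ) ^ (j ^ 2)) ^ (β / α - 1) := by
    calc (2 : ℝ) ^ j ≤ (((q : ℝ) ^ (β / α - 1)) ^ j) ^ j := by gcongr
      _ = _ := by
        rw [← pow_mul, ← sq, ← Real.rpow_natCast, ← Real.rpow_natCast, ← Real.rpow_mul hq0.le,
          ← Real.rpow_mul hq0.le, mul_comm]
  rw [Real.mul_rpow (by norm_num) (scale_pos hq j).le]
  have hs : scale q α j ^ β = (((q : ℝ) ^ (j ^ 2)) ^ (β / α))⁻¹ := by
    rw [scale, ← Real.rpow_mul hB.le, ← Real.rpow_neg hB.le]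
    congr 1; field_simp
  have e : ((q : ℝ) ^ (j ^ 2)) ^ (β / α) =
      ((q : ℝ) ^ (j ^ 2)) ^ (β / α - 1) * (q : ℝ) ^ (j ^ 2) := by
    rw [← Real.rpow_add_one hB.ne', sub_add_cancel]
  rw [hs, e, mul_comm, mul_assoc]
  refine mul_le_of_le_one_right (by positivity) ?_
  rw [inv_mul_le_one₀ (by positivity)]
  gcongr

theorem tendsto_ofReal_scale (hq : 1 < q) (h1 : α⁻¹ > 1) (h4 : 4 ≤ (q : ℝ) ^ (α⁻¹ - 1)) :
    Filter.Tendsto (fun j => ENNReal.ofReal (4 * scale q α j)) Filter.atTop (nhds 0) := by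
  have : Filter.Tendsto (scale q α) Filter.atTop (nhds 0) :=
    (summable_of_abs_le (scale_succ_le_scale hq h1 h4)
      fun j => (abs_of_pos (scale_pos hq j)).le).tendsto_atTop_zero
  simpa using ENNReal.tendsto_ofReal (this.const_mul 4)

theorem dimH_pi_diffSet_le_of_lt (ι : Type*) [Fintype ι] [DecidableEq ι] (hq : 1 < q) (h0 : 0 < α)
    (h1 : α < 1) (h4 : 4 ≤ (q : ℝ) ^ (α⁻¹ - 1)) {β : ℝ} (hβ : α < β) :
    dimH (Set.univ.pi fun _ : ι => diffSet q α) ≤ ENNReal.ofReal (Fintype.card ι * β) := by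
  have h1' : α⁻¹ > 1 := (one_lt_inv₀ h0).2 h1
  have hβ0 : 0 < β := h0.trans hβ
  set N := Fintype.card ι
  refine dimH_le_of_hausdorffMeasure_ne_top (d := (N * β).toNNReal) ?_
  rw [Real.coe_toNNReal _ (by positivity)]
  let t (j : ℕ) (c : ι → ∀ i : Fin j, Fin (2 * q ^ (2 * (i : ℕ) + 1))) : Set (ι → ℝ) :=
    Metric.closedBall (fun l => coverCentre q α j (c l)) (2 * scale q α j)
  have hdiam (j : ℕ) (c) : Metric.ediam (t j c) ≤ ENNReal.ofReal (4 * scale q α j) := by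
    have hs := scale_pos (α := α) hq j
    refine Metric.ediam_le_of_forall_dist_le fun x hx y hy => ?_
    have := dist_triangle_right x y (fun l => coverCentre q α j (c l))
    rw [Metric.mem_closedBall] at hx hy
    linarith
  have hle := Measure.hausdorffMeasure_le_liminf_sum (N * β)
    (Set.univ.pi fun _ : ι => diffSet q α) _ (tendsto_ofReal_scale hq h1' h4) t
    (Filter.Eventually.of_forall hdiam) (Filter.Eventually.of_forall fun j z hz => by
      choose c hc using fun l => exists_abs_sub_coverCentre_le hq h1' h4 (hz l trivial) j
      refine Set.mem_iUnion.2 ⟨c, ?_⟩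
      have hs := scale_pos (α := α) hq j
      exact (dist_pi_le_iff (by positivity)).2 hc)
  refine (lt_of_le_of_lt (hle.trans ?_)
    (ENNReal.ofReal_lt_top (r := ((4 : ℝ) ^ β) ^ N))).ne
  refine Filter.liminf_le_of_frequently_le' (Filter.Eventually.frequently ?_)
  filter_upwards [eventually_card_mul_scale_le hq h0 hβ] with j hj
  have hs := scale_pos (α := α) hq j
  calc ∑ c, Metric.ediam (t j c) ^ (N * β)
      ≤ ∑ _c : ι → ∀ i : Fin j, Fin (2 * q ^ (2 * (i : ℕ) + 1)),
          ENNReal.ofReal (4 * scale q α j) ^ (N * β) := by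
        gcongr with c
        exact hdiam j c
    _ = ENNReal.ofReal (((2 ^ j * (q : ℝ) ^ (j ^ 2)) * (4 * scale q α j) ^ β) ^ N) := by
        rw [Finset.sum_const, Finset.card_univ, Fintype.card_fun, Fintype.card_pi]
        simp only [Fintype.card_fin]
        rw [prod_two_mul_pow, nsmul_eq_mul, ENNReal.ofReal_rpow_of_pos (by positivity),
          mul_comm (N : ℝ) β, Real.rpow_mul (by positivity), Real.rpow_natCast,
          ← ENNReal.ofReal_natCast, ← ENNReal.ofReal_mul (by positivity)]
        push_cast
        rw [← mul_pow]
    _ ≤ _ := by gcongr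

/-- A power of the difference set has no larger dimension than the same power of the Cantor set:
arithmetic progressions whose length grows lose nothing, dimensionally, under differences. -/
theorem dimH_pi_diffSet_le (ι : Type*) [Fintype ι] [DecidableEq ι] (hq : 1 < q) (h0 : 0 < α)
    (h1 : α < 1) (h4 : 4 ≤ (q : ℝ) ^ (α⁻¹ - 1)) :
    dimH (Set.univ.pi fun _ : ι => diffSet q α) ≤ ENNReal.ofReal (Fintype.card ι * α) := by
  have hlim : Filter.Tendsto (fun β : ℝ => ENNReal.ofReal (Fintype.card ι * β))
      (nhdsWithin α (Set.Ioi α)) (nhds (ENNReal.ofReal (Fintype.card ι * α))) :=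
    (ENNReal.continuous_ofReal.comp (continuous_const_mul _)).continuousWithinAt
  exact ge_of_tendsto hlim (by
    filter_upwards [self_mem_nhdsWithin] with β hβ
    exact dimH_pi_diffSet_le_of_lt ι hq h0 h1 h4 hβ)

theorem le_dimH_pi_cantor (ι : Type*) [Fintype ι] (hq : 1 < q) (h0 : 0 < α)
    (h1 : α < 1) (h4 : 4 ≤ (q : ℝ) ^ (α⁻¹ - 1)) :
    ENNReal.ofReal (Fintype.card ι * α) ≤ dimH (Set.univ.pi fun _ : ι => cantor q α) := by
  have hY := abs_denseSum_sub_le_rpow hq h0 h1 h4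
  have : Nonempty (Digits q) := ⟨fun j => ⟨0, by positivity⟩⟩
  let g (x : ℝ) : ℝ := denseSum q (Function.invFun (sparseSum q α) x)
  let f (x : ι → ℝ) : ι → ℝ := fun l => g (x l)
  have hg : ∀ x ∈ cantor q α, ∀ y ∈ cantor q α, |g x - g y| ≤ 4 * |x - y| ^ α := by
    intro x hx y hy
    have := hY (Function.invFun (sparseSum q α) x) (Function.invFun (sparseSum q α) y)
    rwa [Function.invFun_eq hx, Function.invFun_eq hy] at this
  -- Equal sparse sums have equal dense sums, so the choice in `g` does not matter.
  have hgX (a : Digits q) : g (sparseSum q α a) = denseSum q a := by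
    have := hY (Function.invFun (sparseSum q α) (sparseSum q α a)) a
    rw [Function.invFun_eq (f := sparseSum q α) ⟨a, rfl⟩, sub_self, abs_zero,
      Real.zero_rpow h0.ne', mul_zero] at this
    exact sub_eq_zero.1 (abs_nonpos_iff.1 this)
  have hf : HolderOnWith 4 α.toNNReal f (Set.univ.pi fun _ : ι => cantor q α) := by
    intro x hx y hy
    refine edist_pi_le_iff.2 fun l => ?_
    have h := hg _ (hx l trivial) _ (hy l trivial)
    calc edist (g (x l)) (g (y l)) ≤ 4 * edist (x l) (y l) ^ α := by
          rw [edist_dist, edist_dist, Real.dist_eq, Real.dist_eq,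
            ENNReal.ofReal_rpow_of_nonneg (abs_nonneg _) h0.le]
          have : (4 : ℝ≥0∞) = ENNReal.ofReal 4 := by simp
          rw [this, ← ENNReal.ofReal_mul (by norm_num)]
          exact ENNReal.ofReal_le_ofReal h
      _ ≤ 4 * edist x y ^ α := by
          gcongr
          exact edist_le_pi_edist x y l
      _ = _ := by rw [Real.coe_toNNReal _ h0.le]; rfl
  have hdim := hf.dimH_image_le (by simpa using h0)
  have hint : Set.univ.pi (fun _ : ι => Set.Ioo (0 : ℝ) 1) ⊆
      f '' Set.univ.pi fun _ : ι => cantor q α := by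
    intro y hy
    choose a ha using fun l => Ico_subset_range_denseSum hq (Set.Ioo_subset_Ico_self (hy l trivial))
    exact ⟨fun l => sparseSum q α (a l), fun l _ => ⟨a l, rfl⟩, funext fun l => by
      simp only [f, hgX, ha]⟩
  have hopen : IsOpen (Set.univ.pi fun _ : ι => Set.Ioo (0 : ℝ) 1) :=
    isOpen_set_pi Set.finite_univ fun _ _ => isOpen_Ioo
  have hfull : (Fintype.card ι : ℝ≥0∞) ≤ dimH (f '' Set.univ.pi fun _ : ι => cantor q α) := by
    rw [Real.dimH_of_nonempty_interior ⟨fun _ => 1 / 2, interior_mono hint ?_⟩]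
    · simp
    · rw [hopen.interior_eq]
      intro l _
      norm_num
  have := hfull.trans hdim
  rw [ENNReal.le_div_iff_mul_le (by simp [h0]) (by simp)] at this
  rwa [ENNReal.ofReal_mul (by positivity), ENNReal.ofReal_natCast]

/-- Growth of `q ^ (α⁻¹ - 1)` makes the place values decrease fast enough for any `α < 1`. -/
theorem exists_radix (h1 : α⁻¹ > 1) : ∃ q : ℕ, 1 < q ∧ 4 ≤ (q : ℝ) ^ (α⁻¹ - 1) := by
  have ht := (tendsto_rpow_atTop (sub_pos.2 h1)).comp tendsto_natCast_atTop_atTop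
  obtain ⟨q, h4, hq⟩ := ((ht.eventually_ge_atTop 4).and (Filter.eventually_gt_atTop 1)).exists
  exact ⟨q, hq, h4⟩

end MixedRadix

/-- For `0 < α < 1` there is a compact set `C` of reals such that `C ^ n` has dimension exactly
`n * α` and passing to the powers of the difference set `C - C` does not raise the dimension. -/
theorem exists_compact_dimH_pi_sub {α : ℝ} (h0 : 0 < α) (h1 : α < 1) :
    ∃ C : Set ℝ, IsCompact C ∧
      (∀ n : ℕ, dimH (Set.univ.pi fun _ : Fin n => C) = ENNReal.ofReal (n * α)) ∧
      ∀ (ι : Type) [Fintype ι], dimH (Set.univ.pi fun _ : ι => Set.image2 (fun x y => x - y) C C) ≤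
        ENNReal.ofReal (Fintype.card ι * α) := by
  classical
  have h1' : α⁻¹ > 1 := (one_lt_inv₀ h0).2 h1
  obtain ⟨q, hq, h4⟩ := MixedRadix.exists_radix h1'
  refine ⟨MixedRadix.cantor q α, MixedRadix.isCompact_cantor hq h1' h4, fun n => ?_, fun ι _ =>
    MixedRadix.dimH_pi_diffSet_le ι hq h0 h1 h4⟩
  refine le_antisymm ?_ (by simpa using MixedRadix.le_dimH_pi_cantor (Fin n) hq h0 h1 h4)
  refine (dimH_mono (Set.pi_mono fun _ _ => MixedRadix.cantor_subset_diffSet hq)).trans ?_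
  simpa using MixedRadix.dimH_pi_diffSet_le (Fin n) hq h0 h1 h4

namespace Framework

/-! ### Distance sets of Cantor products -/

variable {d k n : ℕ}

/-- The product of `d` copies of a set of reals, as a subset of Euclidean space. -/
def coordProd (d : ℕ) (C : Set ℝ) : Set (EuclideanSpace ℝ (Fin d)) :=
  (EuclideanSpace.equiv (Fin d) ℝ).symm '' Set.univ.pi fun _ => C

theorem mem_coordProd {C : Set ℝ} {x : EuclideanSpace ℝ (Fin d)} :
    x ∈ coordProd d C ↔ ∀ c, x c ∈ C := by
  constructor
  · rintro ⟨z, hz, rfl⟩ c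
    exact hz c trivial
  · exact fun h => ⟨EuclideanSpace.equiv (Fin d) ℝ x, fun c _ => h c, by simp⟩

theorem isCompact_coordProd {C : Set ℝ} (hC : IsCompact C) : IsCompact (coordProd d C) :=
  (isCompact_univ_pi fun _ => hC).image (EuclideanSpace.equiv (Fin d) ℝ).symm.continuous

theorem dimH_coordProd (C : Set ℝ) :
    dimH (coordProd d C) = dimH (Set.univ.pi fun _ : Fin d => C) :=
  ContinuousLinearEquiv.dimH_image _ _

/-- The tuple whose first point is the origin and whose other points have the given coordinates. -/
noncomputable def anchored (k d : ℕ) : (Fin k × Fin d → ℝ) →ₗ[ℝ] Tuple d (k + 1) where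
  toFun z := Fin.cons 0 fun i => WithLp.toLp 2 fun c => z (i, c)
  map_add' z z' := by
    ext i c
    refine Fin.cases ?_ (fun i => ?_) i <;> simp
  map_smul' r z := by
    ext i c
    refine Fin.cases ?_ (fun i => ?_) i <;> simp

theorem exists_lipschitzWith_distMap (G : SimpleGraph (Fin n)) :
    ∃ K, LipschitzWith K (distMap d G) := by
  have h : LipschitzWith 2 fun (x : Tuple d n) (e : edges G) => dist (x e.1.1.1) (x e.1.1.2) := by
    intro x y
    refine edist_pi_le_iff.2 fun e => ?_
    refine (LipschitzWith.dist (x e.1.1.1, x e.1.1.2) (y e.1.1.1, y e.1.1.2)).trans ?_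
    gcongr
    rw [Prod.edist_eq]
    exact max_le (edist_le_pi_edist x y _) (edist_le_pi_edist x y _)
  exact ⟨_, (PiLp.lipschitzWith_toLp 2 _).comp h⟩

/-- Since distances are translation invariant, one vertex may be moved to the origin; hence the
distance set is a Lipschitz image of a power of the difference set with exponent `k * d` only. -/
theorem dimH_distSet_coordProd_le (G : SimpleGraph (Fin (k + 1))) (C : Set ℝ) :
    dimH (distSet G (coordProd d C)) ≤
      dimH (Set.univ.pi fun _ : Fin k × Fin d => Set.image2 (fun x y => x - y) C C) := by
  obtain ⟨K, hK⟩ := exists_lipschitzWith_distMap (d := d) G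
  have hA := (anchored k d).toContinuousLinearMap.lipschitz
  refine le_trans (dimH_mono ?_) ((hK.comp hA).dimH_image_le _)
  rintro _ ⟨x, hx, rfl⟩
  have hx' := fun i => mem_coordProd.1 (hx i)
  refine ⟨fun p => x p.1.succ p.2 - x 0 p.2, fun p _ => ⟨_, hx' _ _, _, hx' _ _, rfl⟩, ?_⟩
  have hanch : anchored k d (fun p => x p.1.succ p.2 - x 0 p.2) = fun i => x i - x 0 := by
    ext i c
    refine Fin.cases ?_ (fun i => ?_) i <;> simp [anchored]
  simp [distMap, hanch]

theorem volume_eq_zero_of_dimH_lt {ι : Type*} [Fintype ι] {s : Set (EuclideanSpace ℝ ι)}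
    (h : dimH s < Fintype.card ι) : volume s = 0 := by
  have himg : volume (EuclideanSpace.equiv ι ℝ '' s) = 0 := by
    rw [← hausdorffMeasure_pi_real]
    refine hausdorffMeasure_of_dimH_lt (d := Fintype.card ι) ?_
    rw [ContinuousLinearEquiv.dimH_image]
    exact_mod_cast h
  refine measure_mono_null (Set.subset_preimage_image (EuclideanSpace.equiv ι ℝ) s) ?_
  exact (PiLp.volume_preserving_ofLp ι).quasiMeasurePreserving.preimage_null himg

/-! ### The differentials of the squared distances -/

/-- The differential at `x` of the squared length of an edge. -/
noncomputable def edgeForm (x : Tuple d n) (e : Edge n) : Tuple d n →ₗ[ℝ] ℝ :=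
  (fderiv ℝ (fun y : Tuple d n => dist (y e.1.1) (y e.1.2) ^ 2) x).toLinearMap

/-- The vector along an edge, as a linear function of the tuple. -/
noncomputable def edgeVector (d : ℕ) (e : Edge n) : Tuple d n →L[ℝ] EuclideanSpace ℝ (Fin d) :=
  ContinuousLinearMap.proj (R := ℝ) (φ := fun _ : Fin n => EuclideanSpace ℝ (Fin d)) e.1.1 -
    ContinuousLinearMap.proj (R := ℝ) (φ := fun _ : Fin n => EuclideanSpace ℝ (Fin d)) e.1.2

theorem hasFDerivAt_sq_dist (x : Tuple d n) (e : Edge n) :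
    HasFDerivAt (fun y : Tuple d n => dist (y e.1.1) (y e.1.2) ^ 2)
      (2 • (innerSL ℝ (edgeVector d e x)).comp (edgeVector d e)) x := by
  simp_rw [dist_eq_norm]
  exact ((edgeVector d e).hasFDerivAt (x := x)).norm_sq

theorem edgeForm_apply (x v : Tuple d n) (e : Edge n) :
    edgeForm x e v = 2 * inner ℝ (x e.1.1 - x e.1.2) (v e.1.1 - v e.1.2) := by
  rw [edgeForm, (hasFDerivAt_sq_dist x e).fderiv]
  simp [edgeVector, inner_sub_left, inner_sub_right]

theorem jacobian_apply (x : Tuple d n) (e : Edge n) (i : Fin n) (c : Fin d) :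
    jacobian x e (i, c) = 2 * (x e.1.1 c - x e.1.2 c) *
      ((if e.1.1 = i then 1 else 0) - (if e.1.2 = i then 1 else 0)) := by
  have h := edgeForm_apply x (Pi.single i (EuclideanSpace.single c 1)) e
  change jacobian x e (i, c) = _ at h
  rw [h, mul_assoc]
  congr 1
  simp only [Pi.single_apply]
  split_ifs <;> simp [EuclideanSpace.inner_single_right]

/-- The values of a linear form at the standard basis of the space of tuples. It sends the
differential `edgeForm x e` to the row `jacobian x e`. -/
noncomputable def coordsOfForm (d n : ℕ) : (Tuple d n →ₗ[ℝ] ℝ) →ₗ[ℝ] (Fin n × Fin d → ℝ) where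
  toFun φ c := φ (Pi.single c.1 (EuclideanSpace.single c.2 1))
  map_add' _ _ := rfl
  map_smul' _ _ := rfl

theorem ker_coordsOfForm : LinearMap.ker (coordsOfForm d n) = ⊥ := by
  refine LinearMap.ker_eq_bot'.2 fun φ hφ => ?_
  refine LinearMap.pi_ext' fun i => ?_
  refine (EuclideanSpace.basisFun (Fin d) ℝ).toBasis.ext fun c => ?_
  simpa [coordsOfForm] using congrFun hφ (i, c)

theorem independentAt_iff_edgeForm (H : Finset (Edge n)) (x : Tuple d n) :
    IndependentAt H x ↔ LinearIndependent ℝ fun e : H => edgeForm x e.1 :=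
  LinearMap.linearIndependent_iff (v := fun e : H => edgeForm x e.1) (coordsOfForm d n)
    ker_coordsOfForm

theorem mem_infMotions {G : SimpleGraph (Fin n)} {x v : Tuple d n} :
    v ∈ infMotions G x ↔ ∀ e ∈ edges G, edgeForm x e v = 0 := by
  have hdiff : DifferentiableAt ℝ (sqDistMap d G) x :=
    (differentiableAt_euclidean).2 fun e => (hasFDerivAt_sq_dist x e.1).differentiableAt
  have hcomp (e : edges G) : (fderiv ℝ (sqDistMap d G) x v) e = edgeForm x e.1 v := by
    have h := (EuclideanSpace.proj (𝕜 := ℝ) e).hasFDerivAt.comp x hdiff.hasFDerivAt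
    have h' : fderiv ℝ (fun y : Tuple d n => dist (y e.1.1.1) (y e.1.1.2) ^ 2) x =
      (EuclideanSpace.proj (𝕜 := ℝ) e).comp (fderiv ℝ (sqDistMap d G) x) := h.fderiv
    rw [edgeForm, h']
    rfl
  rw [infMotions, LinearMap.mem_ker]
  constructor
  · intro h e he
    rw [← hcomp ⟨e, he⟩]
    exact congrArg (fun w : EuclideanSpace ℝ (edges G) => w ⟨e, he⟩) h
  · intro h
    ext e
    exact (hcomp e).trans (h e.1 e.2)

theorem mem_edges {G : SimpleGraph (Fin n)} {e : Edge n} : e ∈ edges G ↔ G.Adj e.1.1 e.1.2 := by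
  simp [edges]

/-! ### Generic tuples -/

/-- The minors of the rows in `H` detect linear independence. -/
theorem minorSum_ne_zero_iff (H : Finset (Edge n)) (x : Tuple d n) :
    minorSum H x ≠ 0 ↔ IndependentAt H x := by
  constructor
  · intro h
    obtain ⟨A, -, hA⟩ := Finset.exists_ne_zero_of_sum_ne_zero h
    have hdet := pow_ne_zero_iff (two_ne_zero) |>.1 hA
    have hli := Matrix.linearIndependent_rows_of_det_ne_zero hdet
    exact LinearIndependent.of_comp
      (LinearMap.funLeft ℝ ℝ fun e' : H => (Finset.equivOfCardEq A.2 e').1) hli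
  · intro h
    let J : Matrix H (Fin n × Fin d) ℝ := fun e => jacobian x e.1
    -- Choose a basis of the column space among the columns; it has `H.card` elements.
    have hrank : J.rank = Fintype.card H := LinearIndependent.rank_matrix h
    obtain ⟨κ, a, ha, hspan, hli⟩ := exists_linearIndependent' ℝ J.col
    have : Finite κ := Finite.of_injective a ha
    have : Fintype κ := Fintype.ofFinite κ
    have hcard : H.card = (Finset.univ.map ⟨a, ha⟩).card := by
      rw [Finset.card_map, Finset.card_univ, ← finrank_span_eq_card hli, hspan,
        ← Matrix.rank_eq_finrank_span_cols, hrank, Fintype.card_coe]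
    refine (Finset.sum_pos' (fun A _ => sq_nonneg _)
      ⟨⟨Finset.univ.map ⟨a, ha⟩, hcard⟩, Finset.mem_univ _, ?_⟩).ne'
    let σ := Finset.equivOfCardEq hcard
    have hmem (e : H) : ∃ t, a t = (σ e).1 := by
      obtain ⟨t, -, ht⟩ := Finset.mem_map.1 (σ e).2
      exact ⟨t, ht⟩
    choose τ hτ using hmem
    have hτinj : Function.Injective τ := fun e e' h => by
      have : (σ e).1 = (σ e').1 := by rw [← hτ, ← hτ, h]
      exact σ.injective (Subtype.ext this)
    have hcols : LinearIndependent ℝ (Matrix.col fun e e' : H => jacobian x e.1 (σ e').1) := by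
      have h' := hli.comp τ hτinj
      have heq : (J.col ∘ a) ∘ τ = Matrix.col fun e e' : H => jacobian x e.1 (σ e').1 := by
        ext e e'
        simp only [Function.comp_apply, hτ]
        rfl
      rwa [heq] at h'
    have hdet := (Matrix.isUnit_iff_isUnit_det _).1
      (Matrix.linearIndependent_cols_iff_isUnit.1 hcols)
    exact sq_pos_of_ne_zero hdet.ne_zero

/-- The entries of the Jacobian matrix as polynomials in the coordinates of the tuple. -/
noncomputable def jacobianPoly (e : Edge n) (c : Fin n × Fin d) :
    MvPolynomial (Fin n × Fin d) ℝ :=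
  2 * (MvPolynomial.X (e.1.1, c.2) - MvPolynomial.X (e.1.2, c.2)) *
    ((if e.1.1 = c.1 then 1 else 0) - (if e.1.2 = c.1 then 1 else 0))

theorem eval_jacobianPoly (x : Tuple d n) (e : Edge n) (c : Fin n × Fin d) :
    MvPolynomial.eval (fun p => x p.1 p.2) (jacobianPoly e c) = jacobian x e c := by
  obtain ⟨i, c⟩ := c
  rw [jacobian_apply, jacobianPoly]
  simp only [map_mul, map_sub, MvPolynomial.eval_X, map_ofNat]
  congr 2 <;> split_ifs <;> simp

theorem exists_eval_eq_minorSum (d : ℕ) (H : Finset (Edge n)) :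
    ∃ p : MvPolynomial (Fin n × Fin d) ℝ,
      ∀ x : Tuple d n, MvPolynomial.eval (fun p => x p.1 p.2) p = minorSum H x := by
  refine ⟨∑ A : {A : Finset (Fin n × Fin d) // H.card = A.card},
    (Matrix.det fun e e' : H => jacobianPoly e.1 (Finset.equivOfCardEq A.2 e').1) ^ 2, fun x => ?_⟩
  rw [map_sum, minorSum]
  refine Finset.sum_congr rfl fun A _ => ?_
  rw [map_pow]
  congr 1
  refine (RingHom.map_det _ _).trans (congrArg Matrix.det ?_)
  ext e e'
  exact eval_jacobianPoly x _ _

/-- Generic tuples exist: a product of nonzero polynomials does not vanish identically. -/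
theorem exists_isGeneric (d n : ℕ) : ∃ x : Tuple d n, IsGeneric x := by
  classical
  choose p hp using fun H : Finset (Edge n) => exists_eval_eq_minorSum d H
  have hne : ∏ H : Finset (Edge n) with H.Nonempty ∧ Independent d H, p H ≠ 0 := by
    refine Finset.prod_ne_zero_iff.2 fun H hH h0 => ?_
    obtain ⟨x, hx⟩ := (Finset.mem_filter.1 hH).2.2
    refine (minorSum_ne_zero_iff H x).2 hx ?_
    rw [← hp, h0, map_zero]
  obtain ⟨z, hz⟩ : ∃ z, MvPolynomial.eval z
      (∏ H : Finset (Edge n) with H.Nonempty ∧ Independent d H, p H) ≠ 0 := by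
    by_contra! h
    exact hne (MvPolynomial.funext fun z => by rw [h z, map_zero])
  let x : Tuple d n := fun i => WithLp.toLp 2 fun c => z (i, c)
  refine ⟨x, ?_⟩
  rw [map_prod] at hz
  rw [IsGeneric, criticalPoly]
  convert hz using 2 with H
  exact (hp H x).symm

theorem IsGeneric.independentAt {x : Tuple d n} (hx : IsGeneric x) {H : Finset (Edge n)}
    (hH : Independent d H) : IndependentAt H x := by
  rcases H.eq_empty_or_nonempty with rfl | hne
  · exact linearIndependent_empty_type
  · rw [← minorSum_ne_zero_iff]
    exact Finset.prod_ne_zero_iff.1 hx H (by simp [hne, hH])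

/-! ### The rank of the complete graph -/

/-- The edges that have an endpoint among the first `d` vertices. -/
def fullRankEdges (n d : ℕ) : Finset (Edge n) := Finset.univ.filter fun e => (e.1.1 : ℕ) < d

/-- At the tuple whose first points are the standard basis vectors and whose other points vanish,
the minor that matches the edge `ij` with the `i`-th coordinate of the `j`-th point is diagonal. -/
theorem independent_fullRankEdges (n d : ℕ) : Independent d (fullRankEdges n d) := by
  classical
  refine ⟨fun i => WithLp.toLp 2 fun c => if (i : ℕ) = c then 1 else 0, ?_⟩
  rw [IndependentAt, Fintype.linearIndependent_iff]
  intro g hg ⟨e₀, he₀⟩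
  have hlt : (e₀.1.1 : ℕ) < d := (Finset.mem_filter.1 he₀).2
  have h := congrFun hg (e₀.1.2, ⟨e₀.1.1, hlt⟩)
  rw [Finset.sum_apply, Finset.sum_eq_single ⟨e₀, he₀⟩] at h
  · have h1 : (e₀.1.1 : ℕ) < e₀.1.2 := e₀.2
    have h2 : e₀.1.1 ≠ e₀.1.2 := e₀.2.ne
    simpa [jacobian_apply, h1.ne', h2] using h
  · rintro ⟨⟨⟨a, b⟩, hab⟩, he⟩ - hne
    obtain ⟨⟨i, j⟩, hij⟩ := e₀
    have hne' : ¬ (a = i ∧ b = j) := by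
      rintro ⟨rfl, rfl⟩; exact hne rfl
    simp only [Pi.smul_apply, jacobian_apply, smul_eq_mul]
    simp only [Fin.lt_def, Fin.ext_iff] at hab hij hne' ⊢
    split_ifs <;> first | omega | simp
  · simp

theorem mul_le_card_fullRankEdges_add (k d : ℕ) :
    d * k ≤ (fullRankEdges (k + 1) d).card + d.choose 2 := by
  classical
  -- The pairs in `S` are the edges in question; those in `T` are at most `1 + 2 + ⋯ + d` in number.
  let S : Finset (Fin (k + 1) × Fin d) := Finset.univ.filter fun p => (p.2 : ℕ) < p.1
  let T : Finset (Fin (k + 1) × Fin d) := Finset.univ.filter fun p => ¬ (p.2 : ℕ) < p.1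
  have hST : S.card + T.card = (k + 1) * d := by
    rw [Finset.card_filter_add_card_filter_not, Finset.card_univ, Fintype.card_prod,
      Fintype.card_fin, Fintype.card_fin]
  have hS : S.card ≤ (fullRankEdges (k + 1) d).card := by
    have hinj : Function.Injective fun p : Fin (k + 1) × Fin d => ((p.2 : ℕ), (p.1 : ℕ)) :=
      fun p p' h => Prod.ext (Fin.ext (congrArg Prod.snd h)) (Fin.ext (congrArg Prod.fst h))
    rw [← Finset.card_image_of_injective S hinj]
    refine (Finset.card_le_card ?_).trans (Finset.card_image_le (s := fullRankEdges (k + 1) d)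
      (f := fun e => ((e.1.1 : ℕ), (e.1.2 : ℕ))))
    intro _ hp
    obtain ⟨⟨j, c⟩, hjc, rfl⟩ := Finset.mem_image.1 hp
    have hlt : (c : ℕ) < j := (Finset.mem_filter.1 hjc).2
    exact Finset.mem_image.2 ⟨⟨(⟨c, hlt.trans j.2⟩, j), hlt⟩,
      Finset.mem_filter.2 ⟨Finset.mem_univ _, c.2⟩, rfl⟩
  have hT : T.card ≤ d.choose 2 + d := by
    have : T.card ≤ ((Finset.range d).sigma fun c => Finset.range (c + 1)).card := by
      refine Finset.card_le_card_of_injOn (fun p => ⟨p.2, p.1⟩) (fun p hp => ?_) fun p _ p' _ h => ?_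
      · have : ¬ (p.2 : ℕ) < p.1 := (Finset.mem_filter.1 hp).2
        simp
        omega
      · simp only [Sigma.mk.injEq] at h
        exact Prod.ext (Fin.ext (eq_of_heq h.2)) (Fin.ext h.1)
    rw [Finset.card_sigma] at this
    simp only [Finset.card_range, Finset.sum_add_distrib, Finset.sum_const, smul_eq_mul,
      mul_one] at this
    rwa [Finset.sum_range_id, ← Nat.choose_two_right] at this
  nlinarith

/-! ### Rigid graphs -/

theorem InfRigid.edgeForm_mem_span {G : SimpleGraph (Fin n)} (hG : InfRigid d G) {x : Tuple d n}
    (hx : IsGeneric x) (e : Edge n) :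
    edgeForm x e ∈ Submodule.span ℝ (Set.range fun e' : edges G => edgeForm x e'.1) := by
  refine mem_span_of_iInf_ker_le_ker fun v hv => ?_
  have h : v ∈ infMotions G x := mem_infMotions.2 fun e' he' => by
    simpa using (Submodule.mem_iInf _).1 hv ⟨e', he'⟩
  rw [hG x hx] at h
  exact mem_infMotions.1 h e (mem_edges.2 e.2.ne)

/-- A set of edges whose differentials span those of all edges at a generic tuple has at least
`d * k - d.choose 2` elements. -/
theorem mul_le_card_add_of_forall_mem_span {x : Tuple d (k + 1)} (hx : IsGeneric x)
    (F : Finset (Edge (k + 1)))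
    (hF : ∀ e, edgeForm x e ∈ Submodule.span ℝ (Set.range fun e' : F => edgeForm x e'.1)) :
    d * k ≤ F.card + d.choose 2 := by
  have hli := (independentAt_iff_edgeForm _ x).1
    (hx.independentAt (independent_fullRankEdges (k + 1) d))
  have h1 := finrank_span_eq_card hli
  have h2 : Submodule.span ℝ (Set.range fun e : fullRankEdges (k + 1) d => edgeForm x e.1) ≤
      Submodule.span ℝ (Set.range fun e' : F => edgeForm x e'.1) := by
    rw [Submodule.span_le]
    rintro _ ⟨e, rfl⟩
    exact hF e
  have h3 := Submodule.finrank_mono h2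
  have h4 : Module.finrank ℝ (Submodule.span ℝ (Set.range fun e' : F => edgeForm x e'.1)) ≤
      F.card := by
    simpa [Set.finrank] using finrank_range_le_card (R := ℝ) fun e' : F => edgeForm x e'.1
  have h5 := mul_le_card_fullRankEdges_add k d
  rw [Fintype.card_coe] at h1
  omega

theorem InfRigid.mul_le_card_edges_add {G : SimpleGraph (Fin (k + 1))} (hG : InfRigid d G) :
    d * k ≤ (edges G).card + d.choose 2 := by
  obtain ⟨x, hx⟩ := exists_isGeneric d (k + 1)
  exact mul_le_card_add_of_forall_mem_span hx _ (hG.edgeForm_mem_span hx)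

theorem InfRigid.mul_le_card_add {G : SimpleGraph (Fin (k + 1))} (hG : InfRigid d G)
    {H : Finset (Edge (k + 1))} (hH : MaximallyIndependent d G H) :
    d * k ≤ H.card + d.choose 2 := by
  classical
  obtain ⟨x, hx⟩ := exists_isGeneric d (k + 1)
  obtain ⟨hsub, hind, hmax⟩ := hH
  have hli := (independentAt_iff_edgeForm _ x).1 (hx.independentAt hind)
  refine mul_le_card_add_of_forall_mem_span hx _ fun e => ?_
  refine Submodule.span_le.2 ?_ (hG.edgeForm_mem_span hx e)
  rintro _ ⟨⟨e', he'⟩, rfl⟩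
  by_contra hnot
  have he'H : e' ∉ H := fun h => hnot (Submodule.subset_span ⟨⟨e', h⟩, rfl⟩)
  refine hmax (insert e' H) (Finset.insert_subset he' hsub) (Finset.ssubset_insert he'H) ⟨x, ?_⟩
  rw [independentAt_iff_edgeForm]
  have hli' : LinearIndepOn ℝ (edgeForm x) (insert e' (H : Set (Edge (k + 1)))) := by
    refine LinearIndepOn.insert hli ?_
    rwa [Set.image_eq_range]
  have : ((insert e' H : Finset (Edge (k + 1))) : Set (Edge (k + 1))) = insert e' (H : Set _) :=
    Finset.coe_insert _ _
  rw [← this] at hli'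
  exact hli'

theorem independent_singleton (hd : 0 < d) (e : Edge n) : Independent d {e} := by
  refine ⟨Pi.single e.1.1 (EuclideanSpace.single ⟨0, hd⟩ 1), ?_⟩
  have h := e.2.ne'
  have hne : jacobian (Pi.single e.1.1 (EuclideanSpace.single ⟨0, hd⟩ 1) : Tuple d n) e ≠ 0 := by
    intro h0
    have := congrFun h0 (e.1.1, ⟨0, hd⟩)
    simp [jacobian_apply, h] at this
  refine linearIndependent_unique_iff.2 ?_
  exact hne

theorem IsGeneric.ne {x : Tuple d n} (hx : IsGeneric x) (hd : 0 < d) {i j : Fin n} (hij : i ≠ j) :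
    x i ≠ x j := by
  wlog hlt : i < j generalizing i j
  · exact (this hij.symm (hij.lt_or_gt.resolve_left hlt)).symm
  intro h
  have hli := (independentAt_iff_edgeForm _ x).1
    (hx.independentAt (independent_singleton hd ⟨(i, j), hlt⟩))
  refine hli.ne_zero ⟨⟨(i, j), hlt⟩, Finset.mem_singleton_self _⟩ ?_
  refine LinearMap.ext fun v => ?_
  simp [edgeForm_apply, h]

/-- If `G` were disconnected, moving one component and fixing the others would be an infinitesimal
motion of `G` that changes the distance between some pair of vertices. -/
theorem InfRigid.connected (hd : 0 < d) {G : SimpleGraph (Fin (k + 1))} (hG : InfRigid d G) :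
    G.Connected := by
  classical
  refine ⟨fun a b => ?_⟩
  by_contra hab
  obtain ⟨x, hx⟩ := exists_isGeneric d (k + 1)
  have hne : a ≠ b := by rintro rfl; exact hab (SimpleGraph.Reachable.refl a)
  let v : Tuple d (k + 1) := fun i => if G.Reachable a i then x a - x b else 0
  have hv : v ∈ infMotions G x := mem_infMotions.2 fun e he => by
    have hadj := (mem_edges.1 he).reachable
    have : v e.1.1 = v e.1.2 := by
      have : G.Reachable a e.1.1 ↔ G.Reachable a e.1.2 :=
        ⟨fun h => h.trans hadj, fun h => h.trans hadj.symm⟩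
      simp only [v, this]
    rw [edgeForm_apply, this, sub_self, inner_zero_right, mul_zero]
  rw [hG x hx, mem_infMotions] at hv
  have hva : v a = x a - x b := if_pos (SimpleGraph.Reachable.refl a)
  have hvb : v b = 0 := if_neg hab
  have hz : inner ℝ (x a - x b) (x a - x b) = (0 : ℝ) := by
    rcases hne.lt_or_gt with h | h
    · have := hv ⟨(a, b), h⟩ (mem_edges.2 h.ne)
      simpa [edgeForm_apply, hva, hvb] using this
    · have := hv ⟨(b, a), h⟩ (mem_edges.2 h.ne)
      rw [edgeForm_apply, hva, hvb, zero_sub, inner_neg_right, ← inner_neg_left, neg_sub] at this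
      simpa using this
  exact hx.ne hd hne (sub_eq_zero.1 (inner_self_eq_zero.1 hz))

theorem exists_minInfRigid (d n : ℕ) : ∃ G : SimpleGraph (Fin n), MinInfRigid d G := by
  obtain ⟨G, hG, hmin⟩ := WellFounded.has_min (wellFounded_lt (α := SimpleGraph (Fin n)))
    {G | InfRigid d G} ⟨⊤, fun _ _ => rfl⟩
  exact ⟨G, hG, fun G' hlt hG' => hmin G' hG' hlt⟩

end Framework

theorem theorem2p4 (d k : ℕ) (hd : 2 ≤ d) (hk : 1 ≤ k) (s : ℝ) (hs0 : 0 < s) (hsd : s < d)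
    (hs : s < (d : ℝ) - (d.choose 2 : ℝ) / (k : ℝ)) :
    (∃ G : SimpleGraph (Fin (k + 1)), G.Connected ∧ Framework.MinInfRigid d G) ∧
    ∃ E : Set (EuclideanSpace ℝ (Fin d)), IsCompact E ∧ dimH E = ENNReal.ofReal s ∧
      (∀ G : SimpleGraph (Fin (k + 1)), Framework.MinInfRigid d G →
        volume (Framework.distSet G E) = 0) ∧
      (∀ (G : SimpleGraph (Fin (k + 1))) (H : Finset (Framework.Edge (k + 1))),
        Framework.InfRigid d G → Framework.MaximallyIndependent d G H →
          dimH (Framework.distSet G E) < (H.card : ℝ≥0∞) ∧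
          Measure.hausdorffMeasure (H.card : ℝ) (Framework.distSet G E) = 0) := by
  constructor
  · obtain ⟨G, hG⟩ := Framework.exists_minInfRigid d (k + 1)
    exact ⟨G, hG.1.connected (by omega), hG⟩
  have hd0 : (0 : ℝ) < d := by positivity
  have hk0 : (0 : ℝ) < k := by positivity
  obtain ⟨C, hC, hdimC, hdimD⟩ := exists_compact_dimH_pi_sub (div_pos hs0 hd0)
    ((div_lt_one hd0).2 hsd)
  have hdist (G : SimpleGraph (Fin (k + 1))) :
      dimH (Framework.distSet G (Framework.coordProd d C)) ≤ ENNReal.ofReal (k * s) := by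
    refine (Framework.dimH_distSet_coordProd_le G C).trans ((hdimD _).trans_eq ?_)
    congr 1
    rw [Fintype.card_prod, Fintype.card_fin, Fintype.card_fin]
    push_cast
    field_simp
  have hlt (m : ℕ) (hm : d * k ≤ m + d.choose 2) : ENNReal.ofReal (k * s) < m := by
    rw [← ENNReal.ofReal_natCast, ENNReal.ofReal_lt_ofReal_iff_of_nonneg (by positivity)]
    have hm' : (d : ℝ) * k ≤ m + d.choose 2 := by exact_mod_cast hm
    have : k * s < k * ((d : ℝ) - (d.choose 2 : ℝ) / (k : ℝ)) := by gcongr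
    rw [mul_sub, mul_div_cancel₀ _ hk0.ne'] at this
    linarith
  refine ⟨Framework.coordProd d C, Framework.isCompact_coordProd hC, ?_, fun G hG => ?_,
    fun G H hG hH => ?_⟩
  · rw [Framework.dimH_coordProd, hdimC]
    congr 1
    field_simp
  · refine Framework.volume_eq_zero_of_dimH_lt ((hdist G).trans_lt ?_)
    rw [Fintype.card_coe]
    exact hlt _ hG.1.mul_le_card_edges_add
  · have h := (hdist G).trans_lt (hlt _ (hG.mul_le_card_add hH))
    exact ⟨h, hausdorffMeasure_of_dimH_lt (d := (H.card : NNReal)) (by exact_mod_cast h)⟩
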